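/- Let $M$ be a $C^\infty$ Hausdorff $2$-dimensional manifold without boundary and let $X$ be a $C^\infty$ vector field on $M$ with zero set $\mathsf Z(X)$. The order of $X$ at a point $p$ is the least integer $n\ge 0$ such that the $n$-jet of $X$ at $p$ is not zero, and $\infty$ if there is no such $n$. For $n\in\{1,2,3,\dots\}\cup\{\infty\}$ let $\mathsf Z_n(X)$ be the set of zeros of $X$ of order $n$. Assume that: (a) $\mathsf Z_\infty(X)=\varnothing$; (b) there is a connected component of $\mathsf Z(X)$ that is not included in a single $\mathsf Z_n(X)$. Then $X$ has a primary singularity, that is, there is a point $p\in\mathsf Z(X)$ such that every $C^\infty$ vector field $Y$ defined on an open neighbourhood $U$ of $p$ and satisfying $[Y,X]=fX$ on $U$ for some continuous function $f\colon U\to\mathbb R$ vanishes at $p$. -/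

import Mathlib

open scoped Manifold ContDiff Topology

noncomputable section

namespace SurfaceVectorField

variable {m : ℕ} {M : Type*} [TopologicalSpace M] [ChartedSpace (EuclideanSpace ℝ (Fin m)) M]

/-- The vector field `X` is of class `C^∞` on the set `U` (used for open sets `U`). -/
def SmoothOn [IsManifold (𝓡 m) ∞ M] (X : ∀ x : M, TangentSpace (𝓡 m) x) (U : Set M) : Prop :=
  ContMDiffOn (𝓡 m) (𝓡 m).tangent ∞
    (fun x => Bundle.TotalSpace.mk' (EuclideanSpace ℝ (Fin m)) x (X x)) U

/-- The vector field `X` read in the preferred chart about `p`: its pullback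
by the inverse of that chart. (`Set.range I` is the whole of `E` in the boundaryless case,
the only one in which this is used.) -/
def localRep {E : Type*} [NormedAddCommGroup E] [NormedSpace ℝ E] {H : Type*} [TopologicalSpace H]
    (I : ModelWithCorners ℝ E H) {M : Type*} [TopologicalSpace M] [ChartedSpace H M]
    (X : ∀ x : M, TangentSpace I x) (p : M) : E → E :=
  VectorField.mpullbackWithin 𝓘(ℝ, E) I (extChartAt I p).symm X (Set.range I)

/-- The `n`-jet of `X` at `p` vanishes: in the chart about `p`, all the partial derivatives
of order at most `n` of the components of `X` are zero at `p`. -/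
def JetVanishes (n : ℕ) (X : ∀ x : M, TangentSpace (𝓡 m) x) (p : M) : Prop :=
  ∀ k ≤ n, iteratedFDeriv ℝ k (localRep (𝓡 m) X p) (extChartAt (𝓡 m) p p) = 0

/-- The order of `X` at `p`: the least `n` such that the `n`-jet of `X` at `p` is not zero,
and `⊤` if there is no such `n` (that is, if `X` is flat at `p`). -/
def order (X : ∀ x : M, TangentSpace (𝓡 m) x) (p : M) : ℕ∞ :=
  ⨅ (n : ℕ) (_ : ¬ JetVanishes n X p), (n : ℕ∞)

/-- The zero set of `X`. -/
def zeros (X : ∀ x : M, TangentSpace (𝓡 m) x) : Set M := {p | X p = 0}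

/-- The set of zeros of `X` of order `n`. -/
def zerosOfOrder (X : ∀ x : M, TangentSpace (𝓡 m) x) (n : ℕ∞) : Set M :=
  {p | p ∈ zeros X ∧ order X p = n}

/-- On the open set `U`, the vector field `Y` tracks `X`: `[Y, X] = f X` for some continuous
function `f` on `U`. -/
def TracksOn (Y X : ∀ x : M, TangentSpace (𝓡 m) x) (U : Set M) : Prop :=
  ∃ f : M → ℝ, ContinuousOn f U ∧
    ∀ x ∈ U, VectorField.mlieBracket (𝓡 m) Y X x = f x • X x

/-- `p` is a primary singularity of `X`: it is a zero of `X`, and every smooth vector field `Y`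
defined on an open neighbourhood `U` of `p` that tracks `X` on `U` vanishes at `p`.
(The values of the total function `Y` outside `U` play no role.) -/
def IsPrimarySingularity [IsManifold (𝓡 m) ∞ M] (X : ∀ x : M, TangentSpace (𝓡 m) x) (p : M) :
    Prop :=
  p ∈ zeros X ∧
    ∀ (U : Set M) (Y : ∀ x : M, TangentSpace (𝓡 m) x), IsOpen U → p ∈ U →
      SmoothOn Y U → TracksOn Y X U → Y p = 0

end SurfaceVectorField

end

/-!
Near a zero that is not a primary singularity and at which `X` is not flat, the order of `X` is
constant on the zero set. If no zero were primary, the order would therefore be constant on every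
connected component of the zero set, against the hypothesis on the components.

Local constancy is a statement in a chart about a zero `p`, given a field `Y` with `Y p ≠ 0` and
`[Y, X] = f X`, that is, `DX(Y) = DY(X) + f X`. Along an orbit of `Y`, the field `X` solves a linear
differential equation, so by Grönwall its norm changes by bounded factors only; the flow of `Y` is
Lipschitz for the same reason. Hence, if `X = O(‖x - p‖ ^ n)` at `p` and `γ` is the orbit of `p`,
then `‖X y‖ ≤ C ‖y - γ t‖ ^ n` for all small `t` and all `y` near `p`
(`exists_orbit_norm_le`). Neither smoothness of the flow nor differentiability of `f` is used.

Let `n` be the order of `X` at `p`. There is a vector `v` with `D^n X(p)(v, …, v) ≠ 0`. The bound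
above shows `D^n X(p)(Y p, …, Y p) = 0`, since the orbit is tangent to `Y p`; so `v` is not parallel
to `Y p`, and as the dimension is two, `(t, s) ↦ γ t + s v` covers a neighbourhood of `p`. By
Taylor's formula in the direction `v`, based at the points `γ t` where `X` vanishes to order `n`, the field
is nonzero at `γ t + s v` for `s ≠ 0`. The zeros near `p` thus lie on the orbit, where the order is
`n` (`eventually_vanishesToOrder_of_zero`).

The argument is run with growth rates `X = O(‖x - p‖ ^ n)`, which are insensitive to a change of
chart; `vanishesToOrder_iff_iteratedFDeriv_eq_zero` identifies them with the vanishing of jets.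
-/

open Filter Asymptotics Set Metric

namespace SurfaceVectorField

universe u

/-! ### Order of vanishing and jets -/

section VanishingOrder

/-- `F` vanishes at `a` to order at least `n`, in the sense of growth: `F x = O(‖x - a‖ ^ n)`.
For smooth `F` this says that the derivatives of order less than `n` are zero at `a`. -/
def VanishesToOrder {E G : Type*} [NormedAddCommGroup E] [NormedAddCommGroup G]
    (n : ℕ) (F : E → G) (a : E) : Prop :=
  F =O[𝓝 a] fun x => ‖x - a‖ ^ n

theorem VanishesToOrder.isLittleO {E G : Type*} [NormedAddCommGroup E]
    [NormedAddCommGroup G] {n : ℕ} {F : E → G} {a : E} (h : VanishesToOrder (n + 1) F a) :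
    F =o[𝓝 a] fun x => ‖x - a‖ ^ n :=
  IsBigO.trans_isLittleO h (isLittleO_pow_sub_pow_sub a n.lt_succ_self)

variable {E G : Type*} [NormedAddCommGroup E] [NormedSpace ℝ E]
  [NormedAddCommGroup G] [NormedSpace ℝ G]

/-- Taylor's formula with integral remainder, when all terms but the remainder vanish. -/
theorem taylor_of_diagonal_eq_zero [CompleteSpace G] {n : ℕ} {F : E → G} {a v : E}
    (hF : ∀ t ∈ Icc (0 : ℝ) 1, ContDiffAt ℝ (n + 1) F (a + t • v))
    (h : ∀ k ≤ n, iteratedFDeriv ℝ k F a (fun _ => v) = 0) :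
    F (a + v) = (n.factorial : ℝ)⁻¹ •
      ∫ t in (0 : ℝ)..1, (1 - t) ^ n • iteratedFDeriv ℝ (n + 1) F (a + t • v) (fun _ => v) := by
  rw [map_add_eq_sum_add_integral_iteratedFDeriv hF, Finset.sum_eq_zero, zero_add]
  intro k hk
  rw [h k (Nat.lt_succ_iff.1 (Finset.mem_range.1 hk)), smul_zero]

/-- Only the diagonal values of the derivatives enter Taylor's formula, so the vanishing of these
suffices. This gives, without polarization, a direction in which the first nonzero derivative is
nonzero. -/
theorem vanishesToOrder_of_diagonal_eq_zero [CompleteSpace G] {n : ℕ} {F : E → G} {a : E}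
    (hF : ContDiffAt ℝ ∞ F a)
    (h : ∀ k < n, ∀ v : E, iteratedFDeriv ℝ k F a (fun _ => v) = 0) : VanishesToOrder n F a := by
  have hF' : ∀ m : ℕ, ContDiffAt ℝ m F a := fun m => hF.of_le (by exact_mod_cast le_top)
  rcases n with _ | n
  · simpa [VanishesToOrder] using hF.continuousAt.norm.isBoundedUnder_le
  have hcont : ContinuousAt (iteratedFDeriv ℝ (n + 1) F) a :=
    (hF' (n + 1)).continuousAt_iteratedFDeriv le_rfl
  have hbd : ∀ᶠ x in 𝓝 a, ‖iteratedFDeriv ℝ (n + 1) F x‖ < ‖iteratedFDeriv ℝ (n + 1) F a‖ + 1 :=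
    hcont.norm.eventually_lt continuousAt_const (by linarith)
  have hsm := (hF' (n + 1)).eventually (by simp)
  obtain ⟨δ, hδ, hball⟩ := Metric.eventually_nhds_iff_ball.1 (hbd.and hsm)
  set C := ‖iteratedFDeriv ℝ (n + 1) F a‖ + 1
  refine IsBigO.of_bound ((n.factorial : ℝ)⁻¹ * C) ?_
  filter_upwards [Metric.ball_mem_nhds a hδ] with x hx
  have hmem : ∀ t ∈ Icc (0 : ℝ) 1, a + t • (x - a) ∈ ball a δ := by
    intro t ht
    exact (convex_ball a δ).add_smul_sub_mem (mem_ball_self hδ) hx ht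
  have key := taylor_of_diagonal_eq_zero (n := n) (F := F) (a := a) (v := x - a)
    (fun t ht => by exact_mod_cast (hball _ (hmem t ht)).2) (fun k hk => h k (by omega) _)
  rw [add_sub_cancel] at key
  rw [key, norm_smul, norm_inv, Real.norm_of_nonneg (Nat.cast_nonneg _), mul_assoc]
  gcongr
  refine (intervalIntegral.norm_integral_le_of_norm_le_const
    (C := C * ‖x - a‖ ^ (n + 1)) fun t ht => ?_).trans (by simp)
  rw [uIoc_of_le zero_le_one] at ht
  have h1 := (hball _ (hmem t ⟨ht.1.le, ht.2⟩)).1.le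
  rw [norm_smul, norm_pow, Real.norm_of_nonneg (by linarith [ht.2])]
  calc (1 - t) ^ n * ‖iteratedFDeriv ℝ (n + 1) F (a + t • (x - a)) fun _ => x - a‖
      ≤ 1 * (C * ‖x - a‖ ^ (n + 1)) := by
        gcongr
        · exact pow_le_one₀ (by linarith [ht.2]) (by linarith [ht.1])
        · refine (ContinuousMultilinearMap.le_opNorm _ _).trans ?_
          simp only [Finset.prod_const, Finset.card_univ, Fintype.card_fin]
          gcongr
    _ = _ := one_mul _
    _ ≤ _ := by simp

/-- An interpolation inequality: if `F` is small and its second derivative is controlled, the first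
derivative is small. On the ball of radius `ε ‖x - a‖` about `x`, the variation of `F` and the mean
value inequality for `fderiv ℝ F` give `‖fderiv ℝ F x‖ ≤ K ε ‖x - a‖ ^ m`. -/
theorem isLittleO_fderiv {m : ℕ} {F : E → G} {a : E} (hF : ContDiffAt ℝ 2 F a)
    (h0 : F =o[𝓝 a] fun x => ‖x - a‖ ^ (m + 1))
    (h2 : VanishesToOrder (m - 1) (fderiv ℝ (fderiv ℝ F)) a) :
    fderiv ℝ F =o[𝓝 a] fun x => ‖x - a‖ ^ m := by
  have hFa : F a = 0 := by simpa using h0.bound one_pos |>.self_of_nhds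
  have hDa : fderiv ℝ F a = 0 := by
    refine HasFDerivAt.fderiv ((hasFDerivAt_iff_isLittleO).2 ?_)
    simp only [hFa, sub_zero, zero_apply]
    have h1 : (fun x : E => ‖x - a‖ ^ (m + 1)) =O[𝓝 a] fun x => ‖x - a‖ ^ 1 := by
      rcases m.eq_zero_or_pos with rfl | hm
      · exact isBigO_refl _ _
      · exact (isLittleO_pow_sub_pow_sub a (by omega)).isBigO
    simp only [pow_one] at h1
    exact (h0.trans_isBigO h1).of_norm_right
  obtain ⟨C, hC0, hC⟩ := h2.exists_pos
  have hd2 : ∀ᶠ x in 𝓝 a, ContDiffAt ℝ 2 F x := hF.eventually (by simp)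
  obtain ⟨δ, hδ, hball⟩ := Metric.eventually_nhds_iff_ball.1 (hC.bound.and hd2)
  set K : ℝ := 2 * 2 ^ (m + 1) + C * 2 ^ (m - 1)
  have hK : 0 < K := by positivity
  refine IsLittleO.of_bound fun c hc => ?_
  -- `ε ≤ 1 / 2` keeps the ball of radius `ε r` about `x` within distance `2 r` of `a`
  set ε : ℝ := min (1 / 2) (c / K)
  have hε : 0 < ε := by positivity
  have hε1 : ε ≤ 1 / 2 := min_le_left _ _
  have hεc : K * ε ≤ c := by
    have := min_le_right (1 / 2) (c / K)
    rwa [le_div_iff₀ hK, mul_comm] at this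
  obtain ⟨δ', hδ', hball'⟩ := Metric.eventually_nhds_iff_ball.1 (h0.bound (sq_pos_of_pos hε))
  have hδ2 : 0 < min (min δ δ') 1 / 2 := by positivity
  filter_upwards [Metric.ball_mem_nhds a hδ2] with x hx
  rcases eq_or_ne x a with rfl | hxa
  · simp only [hDa, norm_zero]; positivity
  set r := ‖x - a‖ with hr
  have hr0 : 0 < r := norm_pos_iff.2 (sub_ne_zero.2 hxa)
  have hrlt : r < min (min δ δ') 1 / 2 := by simpa [hr, dist_eq_norm] using hx
  have hclose : ∀ y ∈ closedBall x (ε * r), ‖y - a‖ ≤ 2 * r := by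
    intro y hy
    have : ‖y - x‖ ≤ ε * r := by simpa [dist_eq_norm] using hy
    calc ‖y - a‖ = ‖(y - x) + (x - a)‖ := by abel_nf
      _ ≤ ε * r + r := (norm_add_le _ _).trans (by gcongr)
      _ ≤ 2 * r := by nlinarith
  have hin : ∀ y ∈ closedBall x (ε * r), y ∈ ball a δ ∧ y ∈ ball a δ' := by
    intro y hy
    have := hclose y hy
    simp only [mem_ball, dist_eq_norm]
    constructor
    · linarith [min_le_left δ δ', min_le_left (min δ δ') 1]
    · linarith [min_le_right δ δ', min_le_left (min δ δ') 1]
  have hd : ∀ y ∈ closedBall x (ε * r), ‖fderiv ℝ F y - fderiv ℝ F x‖ ≤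
      C * 2 ^ (m - 1) * ε * r ^ m := by
    intro y hy
    have hmv := (convex_closedBall x (ε * r)).norm_image_sub_le_of_norm_fderiv_le
      (f := fderiv ℝ F) (C := C * (2 * r) ^ (m - 1)) (x := x) (y := y) (𝕜 := ℝ) ?_ ?_
      (mem_closedBall_self (by positivity)) hy
    · refine hmv.trans ?_
      have h3 : ‖y - x‖ ≤ ε * r := by simpa [dist_eq_norm] using hy
      have h4 : r ^ (m - 1) * (ε * r) ≤ ε * r ^ m := by
        rcases m with _ | m
        · simp only [zero_tsub, pow_zero, one_mul, mul_one]
          nlinarith [min_le_right (min δ δ') 1]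
        · simp only [Nat.add_sub_cancel]
          apply le_of_eq; ring
      calc C * (2 * r) ^ (m - 1) * ‖y - x‖ ≤ C * (2 * r) ^ (m - 1) * (ε * r) := by gcongr
        _ = C * 2 ^ (m - 1) * (r ^ (m - 1) * (ε * r)) := by rw [mul_pow]; ring
        _ ≤ C * 2 ^ (m - 1) * (ε * r ^ m) := by gcongr
        _ = _ := by ring
    · intro z hz
      exact ((hball z (hin z hz).1).2.fderiv_right (m := 1) (by norm_num)).differentiableAt (by simp)
    · intro z hz
      refine (hball z (hin z hz).1).1.trans ?_
      rw [Real.norm_of_nonneg (by positivity)]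
      gcongr
      exact hclose z hz
  refine (ContinuousLinearMap.opNorm_le_of_unit_norm (C := K * ε * r ^ m) (by positivity)
    fun w hw => ?_).trans ?_
  · set y := x + (ε * r) • w
    have hy : y ∈ closedBall x (ε * r) := by
      simp [y, norm_smul, hw, abs_of_pos hε, abs_of_pos hr0]
    have hx' : x ∈ closedBall x (ε * r) := mem_closedBall_self (by positivity)
    have hT := (convex_closedBall x (ε * r)).norm_image_sub_le_of_norm_hasFDerivWithin_le'
      (f := F) (f' := fderiv ℝ F) (φ := fderiv ℝ F x) (x := x) (y := y)
      (fun z hz => ((hball z (hin z hz).1).2.differentiableAt (by simp)).hasFDerivAt.hasFDerivWithinAt)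
      hd hx' hy
    have hyx : y - x = (ε * r) • w := by simp [y]
    have hFb : ∀ z ∈ closedBall x (ε * r), ‖F z‖ ≤ ε ^ 2 * (2 * r) ^ (m + 1) := by
      intro z hz
      refine (hball' z (hin z hz).2).trans ?_
      rw [Real.norm_of_nonneg (by positivity)]
      gcongr
      exact hclose z hz
    have h5 : ‖fderiv ℝ F x (y - x)‖ ≤ ‖F y‖ + ‖F x‖ + ‖F y - F x - fderiv ℝ F x (y - x)‖ := by
      calc ‖fderiv ℝ F x (y - x)‖ = ‖F y - F x - (F y - F x - fderiv ℝ F x (y - x))‖ := by abel_nf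
        _ ≤ _ := (norm_sub_le _ _).trans (by gcongr; exact norm_sub_le _ _)
    rw [hyx] at h5 hT
    rw [map_smul, norm_smul, Real.norm_of_nonneg (by positivity)] at h5
    rw [norm_smul, hw, Real.norm_of_nonneg (by positivity), mul_one, map_smul] at hT
    have h6 := hFb y hy
    have h7 := hFb x hx'
    refine le_of_mul_le_mul_left ?_ (by positivity : 0 < ε * r)
    calc ε * r * ‖fderiv ℝ F x w‖ ≤ _ := h5
      _ ≤ ε ^ 2 * (2 * r) ^ (m + 1) + ε ^ 2 * (2 * r) ^ (m + 1) +
          C * 2 ^ (m - 1) * ε * r ^ m * (ε * r) := by gcongr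
      _ = ε * r * (K * ε * r ^ m) := by simp only [K]; ring
  · rw [Real.norm_of_nonneg (by positivity)]
    gcongr

end VanishingOrder

section Jets

variable {E G : Type u} [NormedAddCommGroup E] [NormedSpace ℝ E]
  [NormedAddCommGroup G] [NormedSpace ℝ G]

/-- A smooth function that is `o(‖x - a‖ ^ m)` has zero `m`-jet at `a`. The induction passes from
`F` to its derivative through `isLittleO_fderiv`; the symmetry of higher derivatives is not
needed. -/
theorem iteratedFDeriv_eq_zero_of_isLittleO [CompleteSpace G] {m : ℕ} {F : E → G} {a : E}
    (hF : ContDiffAt ℝ ∞ F a) (h : F =o[𝓝 a] fun x => ‖x - a‖ ^ m) :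
    ∀ k ≤ m, iteratedFDeriv ℝ k F a = 0 := by
  induction m generalizing G with
  | zero =>
    intro k hk
    obtain rfl : k = 0 := by omega
    ext v
    have h0 : Tendsto F (𝓝 a) (𝓝 0) := by simpa [isLittleO_one_iff] using h
    simpa using tendsto_nhds_unique hF.continuousAt h0
  | succ m ih =>
    have hlow := ih hF (h.trans (isLittleO_pow_sub_pow_sub a m.lt_succ_self))
    have hD : ContDiffAt ℝ ∞ (fderiv ℝ F) a := hF.fderiv_right (m := ∞) (by simp)
    have hD2 : ContDiffAt ℝ ∞ (fderiv ℝ (fderiv ℝ F)) a := hD.fderiv_right (m := ∞) (by simp)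
    have hvan : VanishesToOrder (m - 1) (fderiv ℝ (fderiv ℝ F)) a := by
      refine vanishesToOrder_of_diagonal_eq_zero hD2 fun k hk v => ?_
      have : iteratedFDeriv ℝ k (fderiv ℝ (fderiv ℝ F)) a = 0 := by
        rw [← norm_eq_zero, norm_iteratedFDeriv_fderiv, norm_iteratedFDeriv_fderiv, norm_eq_zero]
        exact hlow _ (by omega)
      simp [this]
    have hDo := ih hD (isLittleO_fderiv (hF.of_le (by norm_cast)) h hvan)
    intro k hk
    rcases k with _ | k
    · exact hlow 0 (Nat.zero_le _)
    · rw [← norm_eq_zero, ← norm_iteratedFDeriv_fderiv, norm_eq_zero]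
      exact hDo k (by omega)

theorem vanishesToOrder_iff_iteratedFDeriv_eq_zero [CompleteSpace G] {n : ℕ} {F : E → G} {a : E}
    (hF : ContDiffAt ℝ ∞ F a) :
    VanishesToOrder n F a ↔ ∀ k < n, iteratedFDeriv ℝ k F a = 0 := by
  refine ⟨fun h k hk => ?_, fun h => vanishesToOrder_of_diagonal_eq_zero hF fun k hk v => by
    simp [h k hk]⟩
  obtain ⟨m, rfl⟩ : ∃ m, n = m + 1 := ⟨n - 1, by omega⟩
  exact iteratedFDeriv_eq_zero_of_isLittleO hF h.isLittleO k (by omega)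

end Jets

/-! ### Growth of a field along the orbits of another -/

section Flow

variable {E : Type*} [NormedAddCommGroup E] [NormedSpace ℝ E]

/-- Grönwall's inequality in both time directions: `b < a` is allowed. -/
theorem norm_le_exp_mul_norm_of_norm_deriv_le {u u' : ℝ → E} {K a b : ℝ}
    (hu : ∀ t ∈ uIcc a b, HasDerivAt u (u' t) t) (hK : ∀ t ∈ uIcc a b, ‖u' t‖ ≤ K * ‖u t‖) :
    ‖u b‖ ≤ Real.exp (K * |b - a|) * ‖u a‖ := by
  -- forward in time this is the usual form; the general case follows by reversing time
  have forward : ∀ {u u' : ℝ → E} {a b : ℝ}, a ≤ b → (∀ t ∈ Icc a b, HasDerivAt u (u' t) t) →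
      (∀ t ∈ Icc a b, ‖u' t‖ ≤ K * ‖u t‖) → ‖u b‖ ≤ Real.exp (K * |b - a|) * ‖u a‖ := by
    intro u u' a b hab hu hK
    have := norm_le_gronwallBound_of_norm_deriv_right_le (δ := ‖u a‖) (K := K) (ε := 0)
      (fun t ht => (hu t ht).continuousAt.continuousWithinAt)
      (fun t ht => (hu t (Ico_subset_Icc_self ht)).hasDerivWithinAt) le_rfl
      (fun t ht => by simpa using hK t (Ico_subset_Icc_self ht)) b (right_mem_Icc.2 hab)
    rwa [gronwallBound_ε0, mul_comm, ← abs_of_nonneg (sub_nonneg.2 hab)] at this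
  rcases le_total a b with hab | hab
  · rw [uIcc_of_le hab] at hu hK
    exact forward hab hu hK
  · rw [uIcc_of_ge hab] at hu hK
    have hmem : ∀ t ∈ Icc (-a) (-b), -t ∈ Icc b a := fun t ht =>
      ⟨by linarith [ht.2], by linarith [ht.1]⟩
    have := forward (u := fun t => u (-t)) (u' := fun t => -u' (-t)) (neg_le_neg hab)
      (fun t ht => by
        simpa [Function.comp_def] using (hu _ (hmem t ht)).scomp t (hasDerivAt_neg t))
      (fun t ht => by simpa using hK _ (hmem t ht))
    simpa [abs_sub_comm, neg_add_eq_sub] using this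

/-- A local flow of `Y` near `p` that stays in a given neighbourhood of `p`. -/
theorem exists_local_flow [CompleteSpace E] {Y : E → E} {p : E} (hY : ContDiffAt ℝ 1 Y p)
    {s : Set E} (hs : s ∈ 𝓝 p) :
    ∃ δ > 0, ∃ φ : E → ℝ → E, ∀ x ∈ ball p δ, φ x 0 = x ∧
      ∀ t ∈ Ioo (-δ) δ, HasDerivAt (φ x) (Y (φ x t)) t ∧ φ x t ∈ s := by
  obtain ⟨ε, hε, a, r, L, K, hr, hPL⟩ := IsPicardLindelof.of_contDiffAt_one hY
  obtain ⟨φ, hφ, hcont⟩ :=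
    (hPL 0).exists_forall_mem_closedBall_eq_hasDerivWithinAt_continuousOn
  simp only [zero_sub, zero_add] at hφ hcont
  have hr' : (0 : ℝ) < r := hr
  have hmem : closedBall p (r : ℝ) ×ˢ Icc (-ε) ε ∈ 𝓝 (p, (0 : ℝ)) :=
    prod_mem_nhds (closedBall_mem_nhds p hr') (Icc_mem_nhds (by linarith) hε)
  have hφp : φ (p, 0) = p := (hφ p (mem_closedBall_self hr'.le)).1
  have hev : ∀ᶠ z in 𝓝 (p, (0 : ℝ)), φ z ∈ s := by
    refine (hcont.continuousAt hmem).eventually ?_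
    rwa [hφp]
  obtain ⟨δ, hδ, hball⟩ := Metric.eventually_nhds_iff_ball.1 hev
  refine ⟨min δ (min r ε), by positivity, fun x t => φ (x, t), fun x hx => ?_⟩
  have hxr : x ∈ closedBall p (r : ℝ) :=
    ball_subset_closedBall (ball_subset_ball ((min_le_right _ _).trans (min_le_left _ _)) hx)
  refine ⟨(hφ x hxr).1, fun t ht => ⟨?_, ?_⟩⟩
  · have hle : min δ (min (r : ℝ) ε) ≤ ε := (min_le_right _ _).trans (min_le_right _ _)
    have h1 : -ε < t := by linarith [ht.1]
    have h2 : t < ε := by linarith [ht.2]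
    exact ((hφ x hxr).2 t ⟨h1.le, h2.le⟩).hasDerivAt (Icc_mem_nhds h1 h2)
  · refine hball _ ?_
    rw [mem_ball, Prod.dist_eq, max_lt_iff]
    refine ⟨(mem_ball.1 hx).trans_le (min_le_left _ _), ?_⟩
    rw [Real.dist_eq, sub_zero, abs_lt]
    have hle : min δ (min (r : ℝ) ε) ≤ δ := min_le_left _ _
    exact ⟨by linarith [ht.1], by linarith [ht.2]⟩

/-- If the derivative of `X` along `Y` is bounded by a multiple of `X`, and `X` vanishes to order
`n` at `p`, then `X` vanishes to order `n` along the orbit `γ` of `p` under `Y`, with a uniform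
constant.
The field at `y` is compared with the field at the point reached from `y` after time `-t`, whose
distance to `p` is comparable to that of `y` to `γ t`. -/
theorem exists_orbit_norm_le [CompleteSpace E] {F : Type*} [NormedAddCommGroup F] [NormedSpace ℝ F]
    {X : E → F} {Y : E → E} {p : E} {n : ℕ} {L : ℝ}
    (hX : ∀ᶠ x in 𝓝 p, DifferentiableAt ℝ X x) (hY : ContDiffAt ℝ 1 Y p)
    (hL : ∀ᶠ x in 𝓝 p, ‖fderiv ℝ X x (Y x)‖ ≤ L * ‖X x‖) (hn : VanishesToOrder n X p) :
    ∃ γ : ℝ → E, ∃ C : ℝ, ∃ δ > 0, γ 0 = p ∧ (∀ t ∈ Ioo (-δ) δ, HasDerivAt γ (Y (γ t)) t) ∧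
      ∀ t ∈ Ioo (-δ) δ, ∀ y ∈ ball p δ, ‖X y‖ ≤ C * ‖y - γ t‖ ^ n := by
  obtain ⟨C, hC0, hC⟩ := hn.exists_pos
  obtain ⟨K, s, hs, hlip⟩ := hY.exists_lipschitzOnWith
  obtain ⟨δ, hδ, φ, hφ⟩ := exists_local_flow hY
    (hX.and (hL.and (hC.bound.and (eventually_mem_set.2 hs))))
  have hp : p ∈ ball p δ := mem_ball_self hδ
  refine ⟨φ p, Real.exp (|L| * δ) * C * Real.exp (K * δ) ^ n, δ, hδ, (hφ p hp).1,
    fun t ht => ((hφ p hp).2 t ht).1, fun t ht y hy => ?_⟩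
  have habs : |t| ≤ δ := (abs_lt.2 ht).le
  have hmem : ∀ σ ∈ uIcc 0 (-t), σ ∈ Ioo (-δ) δ ∧ t + σ ∈ Ioo (-δ) δ := by
    intro σ hσ
    rcases le_total 0 t with h | h
    · rw [uIcc_of_ge (by linarith)] at hσ
      exact ⟨⟨by linarith [hσ.1, ht.2], by linarith [hσ.2]⟩,
        ⟨by linarith [hσ.1], by linarith [hσ.2, ht.2]⟩⟩
    · rw [uIcc_of_le (by linarith)] at hσ
      exact ⟨⟨by linarith [hσ.1], by linarith [hσ.2, ht.1]⟩,
        ⟨by linarith [hσ.1, ht.1], by linarith [hσ.2]⟩⟩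
  -- `X` along the orbit of `y`, from time `0` back to time `-t`
  have hX' : ‖X y‖ ≤ Real.exp (|L| * δ) * ‖X (φ y (-t))‖ := by
    have := norm_le_exp_mul_norm_of_norm_deriv_le (u := fun σ => X (φ y σ))
      (u' := fun σ => fderiv ℝ X (φ y σ) (Y (φ y σ))) (K := |L|) (a := -t) (b := 0)
      (fun σ hσ => by
        rw [uIcc_comm] at hσ
        have h := (hφ y hy).2 σ (hmem σ hσ).1
        exact h.2.1.hasFDerivAt.comp_hasDerivAt σ h.1)
      (fun σ hσ => by
        rw [uIcc_comm] at hσ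
        have h := (hφ y hy).2 σ (hmem σ hσ).1
        exact h.2.2.1.trans (by gcongr; exact le_abs_self L))
    simp only [(hφ y hy).1, zero_sub, neg_neg] at this
    refine this.trans ?_
    gcongr
  -- the orbit of `y` and the orbit `σ ↦ φ p (t + σ)` of `φ p t`, compared at times `0` and `-t`
  have hw : ‖φ y (-t) - p‖ ≤ Real.exp (K * δ) * ‖y - φ p t‖ := by
    have := norm_le_exp_mul_norm_of_norm_deriv_le (u := fun σ => φ y σ - φ p (t + σ))
      (u' := fun σ => Y (φ y σ) - Y (φ p (t + σ))) (K := K) (a := 0) (b := -t)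
      (fun σ hσ => ((hφ y hy).2 σ (hmem σ hσ).1).1.sub
        (((hφ p hp).2 _ (hmem σ hσ).2).1.comp_const_add t σ))
      (fun σ hσ => hlip.norm_sub_le ((hφ y hy).2 σ (hmem σ hσ).1).2.2.2.2
        ((hφ p hp).2 _ (hmem σ hσ).2).2.2.2.2)
    simp only [(hφ y hy).1, (hφ p hp).1, sub_zero, abs_neg, add_neg_cancel, add_zero] at this
    refine this.trans ?_
    gcongr
  have hb := ((hφ y hy).2 (-t) ⟨by linarith [ht.2], by linarith [ht.1]⟩).2.2.2.1
  rw [Real.norm_of_nonneg (by positivity)] at hb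
  calc ‖X y‖ ≤ Real.exp (|L| * δ) * ‖X (φ y (-t))‖ := hX'
    _ ≤ Real.exp (|L| * δ) * (C * ‖φ y (-t) - p‖ ^ n) := by gcongr
    _ ≤ Real.exp (|L| * δ) * (C * (Real.exp (K * δ) * ‖y - φ p t‖) ^ n) := by gcongr
    _ = _ := by rw [mul_pow]; ring

end Flow

section Zeros

/-- A lower bound on the line through `a` directed by `v`, from a lower bound on the `n`-th
directional derivative. -/
theorem mul_abs_pow_div_factorial_le {E : Type*} [NormedAddCommGroup E] [NormedSpace ℝ E]
    {n : ℕ} (hn : n ≠ 0) {h : E → ℝ} {a v : E} {s c : ℝ}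
    (hh : ∀ t ∈ Icc (0 : ℝ) 1, ContDiffAt ℝ n h (a + t • s • v))
    (h0 : ∀ k < n, iteratedFDeriv ℝ k h a = 0)
    (hlow : ∀ t ∈ Icc (0 : ℝ) 1, c ≤ iteratedFDeriv ℝ n h (a + t • s • v) (fun _ => v)) :
    c * |s| ^ n / n.factorial ≤ |h (a + s • v)| := by
  obtain ⟨m, rfl⟩ : ∃ m, n = m + 1 := ⟨n - 1, by omega⟩
  rw [taylor_of_diagonal_eq_zero (n := m) (F := h) (a := a) (v := s • v) (by exact_mod_cast hh)
    (fun k hk => by simp [h0 k (by omega)])]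
  simp only [ContinuousMultilinearMap.map_smul_univ, Finset.prod_const, Finset.card_univ,
    Fintype.card_fin, smul_eq_mul, mul_left_comm _ (s ^ (m + 1))]
  rw [intervalIntegral.integral_const_mul, abs_mul, abs_mul, abs_pow, abs_inv, Nat.abs_cast]
  have hcont : ContinuousOn (fun t : ℝ => (1 - t) ^ m *
      iteratedFDeriv ℝ (m + 1) h (a + t • s • v) (fun _ => v)) (uIcc 0 1) := by
    rw [uIcc_of_le zero_le_one]
    refine ContinuousOn.mul (by fun_prop) fun t ht => ?_
    have h1 : ContinuousAt (iteratedFDeriv ℝ (m + 1) h) (a + t • s • v) :=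
      (hh t ht).continuousAt_iteratedFDeriv le_rfl
    have h2 : ContinuousAt (fun t : ℝ => iteratedFDeriv ℝ (m + 1) h (a + t • s • v)) t :=
      ContinuousAt.comp (f := fun t : ℝ => a + t • s • v) h1 (by fun_prop)
    exact ((ContinuousMultilinearMap.apply ℝ (fun _ => E) ℝ fun _ => v).continuous.continuousAt.comp
      h2).continuousWithinAt
  have hint : c / (m + 1) ≤ ∫ t in (0 : ℝ)..1, (1 - t) ^ m *
      iteratedFDeriv ℝ (m + 1) h (a + t • s • v) (fun _ => v) := by
    calc c / (m + 1) = ∫ t in (0 : ℝ)..1, (1 - t) ^ m * c := by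
          rw [intervalIntegral.integral_mul_const,
            intervalIntegral.integral_comp_sub_left (fun t : ℝ => t ^ m)]
          simp; ring
      _ ≤ _ := by
          refine intervalIntegral.integral_mono_on zero_le_one
            (Continuous.intervalIntegrable (by fun_prop) _ _) hcont.intervalIntegrable
            fun t ht => ?_
          have : 0 ≤ 1 - t := by linarith [ht.2]
          gcongr
          exact hlow t ht
  rw [Nat.factorial_succ]
  push_cast
  calc c * |s| ^ (m + 1) / ((m + 1) * m.factorial)
      = (m.factorial : ℝ)⁻¹ * (|s| ^ (m + 1) * (c / (m + 1))) := by field_simp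
    _ ≤ _ := by gcongr; exact hint.trans (le_abs_self _)

variable {E F : Type u} [NormedAddCommGroup E] [NormedSpace ℝ E]
  [NormedAddCommGroup F] [NormedSpace ℝ F] [CompleteSpace F]

/-- If the `n`-th derivative of `X` at `p` in the direction `v` is nonzero, then near `p` the field
grows at least like `|s| ^ n` in the direction `v` from any point where it vanishes to order `n`. -/
theorem exists_ball_mul_abs_pow_le_norm {X : E → F} {p v : E} {n : ℕ} (hn : n ≠ 0)
    (hX : ∀ᶠ x in 𝓝 p, ContDiffAt ℝ ∞ X x) (hv : iteratedFDeriv ℝ n X p (fun _ => v) ≠ 0) :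
    ∃ c > 0, ∃ ρ > 0, ∀ a ∈ ball p ρ, ContDiffAt ℝ ∞ X a ∧ iteratedFDeriv ℝ n X a ≠ 0 ∧
      (VanishesToOrder n X a → ∀ s : ℝ, a + s • v ∈ ball p ρ → c * |s| ^ n ≤ ‖X (a + s • v)‖) := by
  have hXp := hX.self_of_nhds
  obtain ⟨ℓ, hℓ1, hℓ⟩ := exists_dual_vector ℝ _ (norm_ne_zero_iff.2 hv)
  set W := iteratedFDeriv ℝ n X p (fun _ => v)
  have hcoe : ∀ {x : E}, ContDiffAt ℝ ∞ X x → ∀ k : ℕ, iteratedFDeriv ℝ k (ℓ ∘ X) x =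
      ℓ.compContinuousMultilinearMap (iteratedFDeriv ℝ k X x) := fun h k =>
    ℓ.iteratedFDeriv_comp_left (n := ∞) h (by exact_mod_cast le_top)
  have hpos : 0 < ‖W‖ := norm_pos_iff.2 hv
  have hev : ∀ᶠ x in 𝓝 p, ContDiffAt ℝ ∞ X x ∧
      ‖W‖ / 2 < iteratedFDeriv ℝ n (ℓ ∘ X) x (fun _ => v) := by
    have h1 : ContinuousAt (iteratedFDeriv ℝ n (ℓ ∘ X)) p :=
      ContDiffAt.continuousAt_iteratedFDeriv (n := ∞)
        (ℓ.contDiff.contDiffAt.comp p hXp) (by exact_mod_cast le_top)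
    have h2 : ContinuousAt (fun x => iteratedFDeriv ℝ n (ℓ ∘ X) x (fun _ => v)) p :=
      (ContinuousMultilinearMap.apply ℝ (fun _ : Fin n => E) ℝ
        fun _ => v).continuous.continuousAt.comp h1
    refine hX.and (h2.eventually_const_lt ?_)
    beta_reduce
    rw [hcoe hXp n]
    change ‖W‖ / 2 < ℓ W
    rw [hℓ]
    simpa using hpos
  obtain ⟨ρ, hρ, hball⟩ := Metric.eventually_nhds_iff_ball.1 hev
  refine ⟨‖W‖ / 2 / n.factorial, by positivity, ρ, hρ, fun a ha => ⟨(hball a ha).1, fun h0 => ?_,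
    fun hvan s hs => ?_⟩⟩
  · have h1 := (hball a ha).2
    rw [hcoe (hball a ha).1 n, h0] at h1
    simp only [ContinuousLinearMap.compContinuousMultilinearMap_coe, Function.comp_apply,
      zero_apply, map_zero] at h1
    linarith
  · have hseg : ∀ τ ∈ Icc (0 : ℝ) 1, a + τ • s • v ∈ ball p ρ := fun τ hτ => by
      simpa using (convex_ball p ρ).add_smul_sub_mem ha hs hτ
    have hlow := mul_abs_pow_div_factorial_le (h := ℓ ∘ X) (c := ‖W‖ / 2) hn
      (fun τ hτ => ℓ.contDiff.contDiffAt.comp _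
        ((hball _ (hseg τ hτ)).1.of_le (by exact_mod_cast le_top)))
      (fun k hk => by
        rw [hcoe (hball a ha).1 k,
          (vanishesToOrder_iff_iteratedFDeriv_eq_zero (hball a ha).1).1 hvan k hk]
        ext; simp)
      (fun τ hτ => (hball _ (hseg τ hτ)).2.le)
    calc ‖W‖ / 2 / n.factorial * |s| ^ n = ‖W‖ / 2 * |s| ^ n / n.factorial := by ring
      _ ≤ |ℓ (X (a + s • v))| := hlow
      _ ≤ ‖X (a + s • v)‖ := by simpa [hℓ1] using ℓ.le_opNorm (X (a + s • v))

/-- A field that vanishes to order `n` along a curve through `p` has zero `n`-th derivative at `p`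
in the direction of the curve. -/
theorem iteratedFDeriv_eq_zero_of_norm_le_orbit {X : E → F} {p w : E} {n : ℕ} (hn : n ≠ 0)
    (hX : ∀ᶠ x in 𝓝 p, ContDiffAt ℝ ∞ X x) (hvan : VanishesToOrder n X p) {γ : ℝ → E} {C δ : ℝ}
    (hδ : 0 < δ) (hγ0 : γ 0 = p) (hγ : HasDerivAt γ w 0)
    (hC : ∀ t ∈ Ioo (-δ) δ, ∀ y ∈ ball p δ, ‖X y‖ ≤ C * ‖y - γ t‖ ^ n) :
    iteratedFDeriv ℝ n X p (fun _ => w) = 0 := by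
  by_contra hne
  obtain ⟨c, hc, ρ, hρ, hlow⟩ := exists_ball_mul_abs_pow_le_norm hn hX hne
  have hmem : ∀ᶠ s : ℝ in 𝓝 0, p + s • w ∈ ball p (min δ ρ) := by
    have hcont : ContinuousAt (fun s : ℝ => p + s • w) 0 := by fun_prop
    exact hcont.eventually_mem
      (by simpa only [zero_smul, add_zero] using ball_mem_nhds p (lt_min hδ hρ))
  have hself : (fun s : ℝ => s ^ n) =O[𝓝 0] fun s => ‖p + s • w - γ s‖ ^ n := by
    refine IsBigO.of_bound (C / c) ?_
    filter_upwards [hmem, Ioo_mem_nhds (neg_lt_zero.2 hδ) hδ] with s hs hs'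
    have h1 := (hlow p (mem_ball_self hρ)).2.2 hvan s (ball_subset_ball (min_le_right _ _) hs)
    have h2 := hC s hs' _ (ball_subset_ball (min_le_left _ _) hs)
    rw [norm_pow, norm_pow, norm_norm, Real.norm_eq_abs, div_mul_eq_mul_div, le_div_iff₀ hc,
      mul_comm]
    exact h1.trans h2
  -- the distance from a point of the tangent line to the orbit is `o(s)`
  have ho : (fun s : ℝ => ‖p + s • w - γ s‖ ^ n) =o[𝓝 0] fun s => s ^ n := by
    refine IsLittleO.pow (IsLittleO.norm_left ?_) (Nat.pos_of_ne_zero hn)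
    have := (hasDerivAt_iff_isLittleO.1 hγ).neg_left
    refine (this.congr_left fun s => ?_).congr_right fun s => ?_
    · rw [hγ0, sub_zero]; abel
    · rw [sub_zero]
  refine isLittleO_irrefl ?_ (hself.trans_isLittleO ho)
  have hfreq : ∃ᶠ s : ℝ in 𝓝 0, s ≠ 0 :=
    (eventually_mem_nhdsWithin (s := {(0 : ℝ)}ᶜ)).frequently.filter_mono nhdsWithin_le_nhds
  exact hfreq.mono fun s hs => pow_ne_zero n hs

/-- The zeros of `X` near `p` lie on the orbit of `p` under `Y`, and the order of `X` there is that
at `p`. -/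
theorem eventually_vanishesToOrder_of_zero {X : E → F} {Y : E → E} {p : E} {n : ℕ} {L : ℝ}
    [CompleteSpace E]
    (hdim : Module.finrank ℝ E = 2) (hn : n ≠ 0)
    (hX : ∀ᶠ x in 𝓝 p, ContDiffAt ℝ ∞ X x) (hY : ContDiffAt ℝ 1 Y p) (hYp : Y p ≠ 0)
    (hL : ∀ᶠ x in 𝓝 p, ‖fderiv ℝ X x (Y x)‖ ≤ L * ‖X x‖)
    (hvan : VanishesToOrder n X p) (hnot : ¬ VanishesToOrder (n + 1) X p) :
    ∀ᶠ q in 𝓝 p, X q = 0 → VanishesToOrder n X q ∧ ¬ VanishesToOrder (n + 1) X q := by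
  have hXp := hX.self_of_nhds
  obtain ⟨γ, C, δ, hδ, hγ0, hγ, hC⟩ := exists_orbit_norm_le
    (hX.mono fun x hx => hx.differentiableAt (by simp)) hY hL hvan
  have h0mem : (0 : ℝ) ∈ Ioo (-δ) δ := ⟨neg_lt_zero.2 hδ, hδ⟩
  have hγd0 : HasDerivAt γ (Y p) 0 := by simpa [hγ0] using hγ 0 h0mem
  -- a direction in which the first nonvanishing derivative at `p` is nonzero
  obtain ⟨v, hv⟩ : ∃ v, iteratedFDeriv ℝ n X p (fun _ => v) ≠ 0 := by
    by_contra! hcon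
    refine hnot (vanishesToOrder_of_diagonal_eq_zero hXp fun k hk v => ?_)
    rcases (Nat.lt_succ_iff.1 hk).lt_or_eq with hk | rfl
    · simp [(vanishesToOrder_iff_iteratedFDeriv_eq_zero hXp).1 hvan k hk]
    · exact hcon v
  have hindep : LinearIndependent ℝ ![Y p, v] := by
    refine (LinearIndependent.pair_iff' hYp).2 fun c hc => hv ?_
    -- if `v = c • Y p`, the `n`-th derivative in the direction `v` would vanish
    have h0 := iteratedFDeriv_eq_zero_of_norm_le_orbit hn hX hvan hδ hγ0 hγd0 hC
    rw [← hc]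
    change iteratedFDeriv ℝ n X p (fun i => (fun _ => c) i • (fun _ => Y p) i) = 0
    rw [ContinuousMultilinearMap.map_smul_univ, h0, smul_zero]
  obtain ⟨c, hc, ρ, hρ, hball⟩ := exists_ball_mul_abs_pow_le_norm hn hX hv
  -- the orbit, thickened in the direction `v`, covers a neighbourhood of `p`
  have hstrict : HasStrictDerivAt γ (Y p) 0 := by
    have hev' : ∀ᶠ t in 𝓝 (0 : ℝ), HasDerivAt γ (Y (γ t)) t :=
      Filter.mem_of_superset (Ioo_mem_nhds h0mem.1 h0mem.2) hγ
    have hYc : ContinuousAt (fun t => Y (γ t)) 0 :=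
      ContinuousAt.comp (by rw [hγ0]; exact hY.continuousAt) hγd0.continuousAt
    have := hasStrictDerivAt_of_hasDerivAt_of_continuousAt hev' hYc
    rwa [hγ0] at this
  set A : ℝ × ℝ →L[ℝ] E := (ContinuousLinearMap.fst ℝ ℝ ℝ).smulRight (Y p) +
    (ContinuousLinearMap.snd ℝ ℝ ℝ).smulRight v
  have hA : HasStrictFDerivAt (fun z : ℝ × ℝ => γ z.1 + z.2 • v) A (0, 0) := by
    have h1 : HasStrictFDerivAt (fun z : ℝ × ℝ => γ z.1)
        ((ContinuousLinearMap.fst ℝ ℝ ℝ).smulRight (Y p)) (0, 0) := by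
      refine ((hstrict.hasStrictFDerivAt).comp (0, (0 : ℝ))
        (ContinuousLinearMap.fst ℝ ℝ ℝ).hasStrictFDerivAt).congr_fderiv ?_
      ext <;> simp
    exact h1.add ((ContinuousLinearMap.snd ℝ ℝ ℝ).smulRight v).hasStrictFDerivAt
  have hsurj : A.range = ⊤ := by
    rw [eq_top_iff, ← hindep.span_eq_top_of_card_eq_finrank (by simp [hdim]), Submodule.span_le]
    rintro _ ⟨i, rfl⟩
    fin_cases i
    · exact ⟨(1, 0), by simp [A]⟩
    · exact ⟨(0, 1), by simp [A]⟩
  have : FiniteDimensional ℝ E := Module.finite_of_finrank_pos (by omega)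
  have hmap := hA.map_nhds_eq_of_surj hsurj
  simp only [hγ0, zero_smul, add_zero] at hmap
  have hsmall : ∀ᶠ z in 𝓝 ((0 : ℝ), (0 : ℝ)), z.1 ∈ Ioo (-δ) δ ∧ γ z.1 ∈ ball p (min δ ρ) ∧
      γ z.1 + z.2 • v ∈ ball p ρ := by
    have hc : ContinuousAt γ (0, (0:ℝ)).1 := hγd0.continuousAt
    have hc1 : ContinuousAt (fun z : ℝ × ℝ => γ z.1) (0, 0) := hc.comp continuousAt_fst
    refine (continuousAt_fst.eventually (Ioo_mem_nhds h0mem.1 h0mem.2)).and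
      ((hc1.eventually_mem ?_).and (hA.continuousAt.eventually_mem ?_))
    · simpa only [hγ0] using ball_mem_nhds p (lt_min hδ hρ)
    · simpa only [hγ0, zero_smul, add_zero] using ball_mem_nhds p hρ
  rw [← hmap]
  refine eventually_map.2 (hsmall.mono ?_)
  rintro ⟨t, s⟩ ⟨ht, hγt, hq⟩ hzero
  have hγδ : γ t ∈ ball p δ := ball_subset_ball (min_le_left _ _) hγt
  have hγρ : γ t ∈ ball p ρ := ball_subset_ball (min_le_right _ _) hγt
  have hvan' : VanishesToOrder n X (γ t) := by
    refine IsBigO.of_bound C ?_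
    filter_upwards [isOpen_ball.mem_nhds hγδ] with y hy
    simpa using hC t ht y hy
  have hs : s = 0 := by
    have h1 := (hball _ hγρ).2.2 hvan' s hq
    rw [hzero, norm_zero] at h1
    by_contra hs
    have : 0 < c * |s| ^ n := by positivity
    linarith
  subst hs
  simp only [zero_smul, add_zero]
  exact ⟨hvan', fun hcon => (hball _ hγρ).2.1
    ((vanishesToOrder_iff_iteratedFDeriv_eq_zero (hball _ hγρ).1).1 hcon n n.lt_succ_self)⟩

end Zeros

/-! ### Vector fields in charts -/

section Charts

variable {E : Type*} [NormedAddCommGroup E] [NormedSpace ℝ E] {H : Type*} [TopologicalSpace H]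
  {I : ModelWithCorners ℝ E H} {M : Type*} [TopologicalSpace M]
  [ChartedSpace H M] [IsManifold I ∞ M] {X Y : ∀ x : M, TangentSpace I x} {p q x : M}

theorem localRep_apply {y : E} (hy : y ∈ (extChartAt I p).target) :
    localRep I X p y =
      (mfderiv I 𝓘(ℝ, E) (extChartAt I p) ((extChartAt I p).symm y)
        (X ((extChartAt I p).symm y)) : E) := by
  rw [localRep, VectorField.mpullbackWithin_apply, ContinuousLinearMap.inverse_eq
    (mfderivWithin_extChartAt_symm_comp_mfderiv_extChartAt hy)
    (mfderiv_extChartAt_comp_mfderivWithin_extChartAt_symm hy)]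
  rfl

theorem localRep_extChartAt (hx : x ∈ (extChartAt I p).source) :
    localRep I X p (extChartAt I p x) = (mfderiv I 𝓘(ℝ, E) (extChartAt I p) x (X x) : E) := by
  have h : ∀ z, z = x → (mfderiv I 𝓘(ℝ, E) (extChartAt I p) z (X z) : E) =
      (mfderiv I 𝓘(ℝ, E) (extChartAt I p) x (X x) : E) := by
    rintro z rfl; rfl
  rw [localRep_apply ((extChartAt I p).map_source hx)]
  exact h _ ((extChartAt I p).left_inv hx)

theorem localRep_eq_zero_iff (hx : x ∈ (extChartAt I p).source) :
    localRep I X p (extChartAt I p x) = 0 ↔ X x = 0 := by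
  rw [localRep_extChartAt hx]
  exact map_eq_zero_iff _ (isInvertible_mfderiv_extChartAt hx).injective

theorem mlieBracket_modelSpace (V W : E → E) :
    VectorField.mlieBracket 𝓘(ℝ, E) V W = VectorField.lieBracket ℝ V W :=
  VectorField.mlieBracketWithin_univ.symm.trans
    (VectorField.mlieBracketWithin_eq_lieBracketWithin.trans VectorField.lieBracketWithin_univ)

variable [I.Boundaryless]

omit [IsManifold I ∞ M] in
theorem localRep_eq_mpullback :
    localRep I X p = VectorField.mpullback 𝓘(ℝ, E) I (extChartAt I p).symm X := by
  rw [localRep, I.range_eq_univ, VectorField.mpullbackWithin_univ]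

theorem contDiffAt_localRep [CompleteSpace E] (hX : ContMDiffAt I I.tangent ∞
    (fun x => Bundle.TotalSpace.mk' E x (X x)) x)
    (hx : x ∈ (extChartAt I p).source) :
    ContDiffAt ℝ ∞ (localRep I X p) (extChartAt I p x) := by
  have hy := (extChartAt I p).map_source hx
  have hchart : ContMDiffAt 𝓘(ℝ, E) I ∞ (extChartAt I p).symm (extChartAt I p x) :=
    (contMDiffOn_extChartAt_symm p).contMDiffAt ((isOpen_extChartAt_target p).mem_nhds hy)
  have hinv := isInvertible_mfderivWithin_extChartAt_symm hy
  rw [I.range_eq_univ, mfderivWithin_univ] at hinv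
  have hpull := ContMDiffAt.mpullback_vectorField_preimage (V := X) (m := ∞) (n := ∞)
    (by rwa [(extChartAt I p).left_inv hx]) hchart hinv (by simp)
  rw [← localRep_eq_mpullback] at hpull
  rw [← contMDiffAt_iff_contDiffAt]
  exact (contMDiff_snd_tangentBundle_modelSpace E 𝓘(ℝ, E)).contMDiffAt.comp _ hpull

theorem lieBracket_localRep [CompleteSpace E]
    (hX : ContMDiffAt I I.tangent ∞ (fun x => Bundle.TotalSpace.mk' E x (X x)) x)
    (hY : ContMDiffAt I I.tangent ∞ (fun x => Bundle.TotalSpace.mk' E x (Y x)) x)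
    (hx : x ∈ (extChartAt I p).source) {c : ℝ}
    (h : VectorField.mlieBracket I Y X x = c • X x) :
    VectorField.lieBracket ℝ (localRep I Y p) (localRep I X p) (extChartAt I p x) =
      c • localRep I X p (extChartAt I p x) := by
  have hy := (extChartAt I p).map_source hx
  have hle : minSmoothness ℝ 2 ≤ ∞ := by
    simp only [minSmoothness_of_isRCLikeNormedField]
    norm_cast
  have : IsManifold I (minSmoothness ℝ 2) M := IsManifold.of_le (n := ∞) hle
  have hxx := (extChartAt I p).left_inv hx
  have hchart : ContMDiffAt 𝓘(ℝ, E) I ∞ (extChartAt I p).symm (extChartAt I p x) :=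
    (contMDiffOn_extChartAt_symm p).contMDiffAt ((isOpen_extChartAt_target p).mem_nhds hy)
  have key := VectorField.mpullback_mlieBracket (I := 𝓘(ℝ, E)) (I' := I)
    (f := (extChartAt I p).symm) (x₀ := extChartAt I p x) (V := Y) (W := X) (n := ∞)
    (by rw [hxx]; exact hY.mdifferentiableAt (by simp))
    (by rw [hxx]; exact hX.mdifferentiableAt (by simp)) hchart hle
  have hbr : localRep I (VectorField.mlieBracket I Y X) p (extChartAt I p x) =
      VectorField.lieBracket ℝ (localRep I Y p) (localRep I X p) (extChartAt I p x) := by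
    rw [localRep_eq_mpullback, localRep_eq_mpullback, localRep_eq_mpullback]
    exact key.trans (congrFun (mlieBracket_modelSpace _ _) _)
  rw [← hbr, localRep_extChartAt hx, localRep_extChartAt hx, h]
  exact map_smul (mfderiv I 𝓘(ℝ, E) (extChartAt I p) x) c (X x)

/-- The representatives of `X` in two charts are related by the derivative of the transition map. -/
theorem localRep_transition (hp : x ∈ (extChartAt I p).source)
    (hq : x ∈ (extChartAt I q).source) :
    localRep I X q (extChartAt I q x) =
      fderiv ℝ (extChartAt I q ∘ (extChartAt I p).symm) (extChartAt I p x)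
        (localRep I X p (extChartAt I p x)) := by
  have hy := (extChartAt I p).map_source hp
  have hxx := (extChartAt I p).left_inv hp
  have hsymm : MDifferentiableAt 𝓘(ℝ, E) I (extChartAt I p).symm (extChartAt I p x) :=
    ((contMDiffOn_extChartAt_symm (n := ∞) p).contMDiffAt
      ((isOpen_extChartAt_target p).mem_nhds hy)).mdifferentiableAt (by simp)
  have hchart : MDifferentiableAt I 𝓘(ℝ, E) (extChartAt I q)
      ((extChartAt I p).symm (extChartAt I p x)) := by
    rw [hxx]
    exact mdifferentiableAt_extChartAt (by rwa [← extChartAt_source (I := I)])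
  have hid := mfderivWithin_extChartAt_symm_comp_mfderiv_extChartAt hy
  rw [I.range_eq_univ, mfderivWithin_univ] at hid
  have h : ∀ z, z = x → (mfderiv I 𝓘(ℝ, E) (extChartAt I q) x (X x) : E) =
      (mfderiv I 𝓘(ℝ, E) (extChartAt I q) z (X z) : E) := by
    rintro z rfl; rfl
  rw [localRep_extChartAt hq, h _ hxx, localRep_apply hy, ← mfderiv_eq_fderiv,
    mfderiv_comp _ hchart hsymm]
  refine congrArg (mfderiv I 𝓘(ℝ, E) (extChartAt I q) _) ?_
  exact (congrArg (fun A => A (X ((extChartAt I p).symm (extChartAt I p x)))) hid).symm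

theorem contDiffAt_transition (hp : x ∈ (extChartAt I p).source)
    (hq : x ∈ (extChartAt I q).source) :
    ContDiffAt ℝ ∞ (extChartAt I q ∘ (extChartAt I p).symm) (extChartAt I p x) := by
  have hy := (extChartAt I p).map_source hp
  rw [← contMDiffAt_iff_contDiffAt]
  refine ContMDiffAt.comp (I' := I) _ ?_ ((contMDiffOn_extChartAt_symm (n := ∞) p).contMDiffAt
      ((isOpen_extChartAt_target p).mem_nhds hy))
  rw [(extChartAt I p).left_inv hp]
  exact contMDiffAt_extChartAt' (by rwa [← extChartAt_source (I := I)])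

/-- The growth order does not depend on the chart. -/
theorem vanishesToOrder_localRep_of_mem_source {n : ℕ} (hp : x ∈ (extChartAt I p).source)
    (hq : x ∈ (extChartAt I q).source)
    (h : VanishesToOrder n (localRep I X p) (extChartAt I p x)) :
    VanishesToOrder n (localRep I X q) (extChartAt I q x) := by
  have hcd := contDiffAt_transition hp hq
  have hcd' := (contDiffAt_transition hq hp).differentiableAt (by simp)
  have hsymm : Tendsto (extChartAt I q).symm (𝓝 (extChartAt I q x)) (𝓝 x) := by
    have := continuousAt_extChartAt_symm'' ((extChartAt I q).map_source hq)
    rwa [ContinuousAt, (extChartAt I q).left_inv hq] at this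
  have hτ : Tendsto (extChartAt I p ∘ (extChartAt I q).symm) (𝓝 (extChartAt I q x))
      (𝓝 (extChartAt I p x)) :=
    (continuousAt_extChartAt' hp).tendsto.comp hsymm
  obtain ⟨C, hC0, hC⟩ :=
    ((hcd.continuousAt_fderiv (by simp)).norm.isBoundedUnder_le.isBigO_one ℝ).exists_pos
  have h1 : localRep I X q =O[𝓝 (extChartAt I q x)]
      fun y => localRep I X p ((extChartAt I p ∘ (extChartAt I q).symm) y) := by
    refine IsBigO.of_bound C ?_
    filter_upwards [hτ.eventually hC.bound,
      hsymm.eventually ((isOpen_extChartAt_source p).mem_nhds hp),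
      hsymm.eventually ((isOpen_extChartAt_source q).mem_nhds hq),
      (isOpen_extChartAt_target q).mem_nhds ((extChartAt I q).map_source hq)]
      with y hy hyp hyq hyt
    have := localRep_transition (X := X) hyp hyq
    rw [(extChartAt I q).right_inv hyt] at this
    rw [this]
    refine (ContinuousLinearMap.le_opNorm _ _).trans ?_
    rw [norm_one, mul_one] at hy
    exact mul_le_mul_of_nonneg_right hy (norm_nonneg _)
  refine h1.trans ((IsBigO.comp_tendsto h hτ).trans ?_)
  refine IsBigO.pow (IsBigO.norm_left ?_) n
  have := hcd'.isBigO_sub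
  simp only [Function.comp_apply, (extChartAt I q).left_inv hq] at this
  exact this.norm_right

end Charts

section Order

variable {m : ℕ} {M : Type*} [TopologicalSpace M] [ChartedSpace (EuclideanSpace ℝ (Fin m)) M]
  [IsManifold (𝓡 m) ∞ M] {X Y : ∀ x : M, TangentSpace (𝓡 m) x} {p q x : M}

/-- The jet at `q` is defined in the preferred chart of `q`, but may be tested in any chart. -/
theorem jetVanishes_iff {n : ℕ} (hX : ContMDiffAt (𝓡 m) (𝓡 m).tangent ∞
    (fun x => Bundle.TotalSpace.mk' (EuclideanSpace ℝ (Fin m)) x (X x)) q)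
    (hq : q ∈ (extChartAt (𝓡 m) p).source) :
    JetVanishes n X q ↔ VanishesToOrder (n + 1) (localRep (𝓡 m) X p) (extChartAt (𝓡 m) p q) := by
  have hqq := mem_extChartAt_source (I := 𝓡 m) q
  have h1 : VanishesToOrder (n + 1) (localRep (𝓡 m) X p) (extChartAt (𝓡 m) p q) ↔
      VanishesToOrder (n + 1) (localRep (𝓡 m) X q) (extChartAt (𝓡 m) q q) :=
    ⟨vanishesToOrder_localRep_of_mem_source hq hqq,
      vanishesToOrder_localRep_of_mem_source hqq hq⟩
  rw [h1, vanishesToOrder_iff_iteratedFDeriv_eq_zero (contDiffAt_localRep hX hqq)]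
  simp only [JetVanishes, Nat.lt_succ_iff]

omit [IsManifold (𝓡 m) ∞ M] in
theorem order_eq_coe_iff {n : ℕ} : order X p = n ↔ (∀ k < n, JetVanishes k X p) ∧
    ¬ JetVanishes n X p := by
  constructor
  · intro h
    have hlow : ∀ k < n, JetVanishes k X p := by
      intro k hk
      by_contra hcon
      have : order X p ≤ k := iInf₂_le k hcon
      rw [h] at this
      exact absurd (by exact_mod_cast this) (not_le.2 hk)
    refine ⟨hlow, fun hn => ?_⟩
    have : ((n + 1 : ℕ) : ℕ∞) ≤ order X p := by
      refine le_iInf₂ fun k hk => ?_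
      by_contra! hlt
      have hlt' : k < n + 1 := by exact_mod_cast hlt
      exact hk fun j hj => hn j (by omega)
    rw [h] at this
    have : n + 1 ≤ n := by exact_mod_cast this
    omega
  · rintro ⟨hlow, hn⟩
    refine le_antisymm (iInf₂_le n hn) (le_iInf₂ fun k hk => ?_)
    by_contra! hlt
    exact hk (hlow k (by exact_mod_cast hlt))

theorem order_eq_coe_iff_vanishesToOrder {n : ℕ} (hn : n ≠ 0)
    (hX : ContMDiffAt (𝓡 m) (𝓡 m).tangent ∞
      (fun x => Bundle.TotalSpace.mk' (EuclideanSpace ℝ (Fin m)) x (X x)) q)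
    (hq : q ∈ (extChartAt (𝓡 m) p).source) :
    order X q = n ↔ VanishesToOrder n (localRep (𝓡 m) X p) (extChartAt (𝓡 m) p q) ∧
      ¬ VanishesToOrder (n + 1) (localRep (𝓡 m) X p) (extChartAt (𝓡 m) p q) := by
  obtain ⟨k, rfl⟩ : ∃ k, n = k + 1 := ⟨n - 1, by omega⟩
  rw [order_eq_coe_iff, jetVanishes_iff hX hq, ← jetVanishes_iff (n := k) hX hq]
  refine and_congr_left' ⟨fun h => h k k.lt_succ_self, fun h j hj i hi => h i (by omega)⟩

theorem order_ne_zero (hq : X q = 0) : order X q ≠ 0 := by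
  have h0 : JetVanishes 0 X q := by
    intro k hk
    obtain rfl : k = 0 := by omega
    refine ContinuousMultilinearMap.ext fun v => ?_
    rw [iteratedFDeriv_zero_apply]
    exact (localRep_eq_zero_iff (mem_extChartAt_source (I := 𝓡 m) q)).2 hq
  intro h
  exact (order_eq_coe_iff.1 (h.trans Nat.cast_zero.symm)).2 h0

/-- At a zero where `X` is not flat and which is not a primary singularity, the order of `X` is
locally constant on the zero set. -/
theorem eventually_order_eq {M : Type*} [TopologicalSpace M]
    [ChartedSpace (EuclideanSpace ℝ (Fin 2)) M] [IsManifold (𝓡 2) ∞ M]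
    {X Y : ∀ x : M, TangentSpace (𝓡 2) x} {p : M} {U : Set M} (hX : SmoothOn X univ)
    (hU : IsOpen U) (hpU : p ∈ U) (hY : SmoothOn Y U) (htrack : TracksOn Y X U) (hYp : Y p ≠ 0)
    (hp : X p = 0) (hfin : order X p ≠ ⊤) :
    ∀ᶠ q in 𝓝 p, X q = 0 → order X q = order X p := by
  obtain ⟨n, hn⟩ := ENat.ne_top_iff_exists.1 hfin
  have hn0 : n ≠ 0 := by
    rintro rfl
    exact order_ne_zero hp hn.symm
  set φ := extChartAt (𝓡 2) p
  have hpφ : p ∈ φ.source := mem_extChartAt_source p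
  have hXat : ∀ x, ContMDiffAt (𝓡 2) (𝓡 2).tangent ∞
      (fun x => Bundle.TotalSpace.mk' (EuclideanSpace ℝ (Fin 2)) x (X x)) x := fun x =>
    hX.contMDiffAt univ_mem
  obtain ⟨f, hf, hbr⟩ := htrack
  have hvan := (order_eq_coe_iff_vanishesToOrder hn0 (hXat p) hpφ).1 hn.symm
  have hsymm : Tendsto φ.symm (𝓝 (φ p)) (𝓝 p) := by
    have := continuousAt_extChartAt_symm (I := 𝓡 2) p
    rwa [ContinuousAt, φ.left_inv hpφ] at this
  have htgt : ∀ᶠ y in 𝓝 (φ p), y ∈ φ.target ∧ φ.symm y ∈ U :=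
    Filter.Eventually.and ((isOpen_extChartAt_target p).mem_nhds (φ.map_source hpφ))
      (hsymm.eventually (hU.mem_nhds hpU))
  have hXrep : ∀ᶠ y in 𝓝 (φ p), ContDiffAt ℝ ∞ (localRep (𝓡 2) X p) y := by
    filter_upwards [htgt] with y hy
    have := contDiffAt_localRep (hXat (φ.symm y)) (φ.map_target hy.1)
    rwa [φ.right_inv hy.1] at this
  have hYrep : ContDiffAt ℝ ∞ (localRep (𝓡 2) Y p) (φ p) :=
    contDiffAt_localRep (hY.contMDiffAt (hU.mem_nhds hpU)) hpφ
  have hYrep1 : ContDiffAt ℝ 1 (localRep (𝓡 2) Y p) (φ p) :=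
    hYrep.of_le (by exact_mod_cast le_top)
  have hYne : localRep (𝓡 2) Y p (φ p) ≠ 0 := fun h => hYp ((localRep_eq_zero_iff hpφ).1 h)
  -- near `φ p` the derivative of `X` along `Y` is controlled by `X` itself
  set D := ‖fderiv ℝ (localRep (𝓡 2) Y p) (φ p)‖ + 1
  have hD : ∀ᶠ y in 𝓝 (φ p), ‖fderiv ℝ (localRep (𝓡 2) Y p) y‖ < D :=
    (hYrep1.continuousAt_fderiv (by simp)).norm.eventually_lt continuousAt_const (by simp [D])
  have hfb : ∀ᶠ y in 𝓝 (φ p), ‖f (φ.symm y)‖ < ‖f p‖ + 1 :=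
    hsymm.eventually ((hf.continuousAt (hU.mem_nhds hpU)).norm.eventually_lt
      continuousAt_const (by simp))
  have hL : ∀ᶠ y in 𝓝 (φ p), ‖fderiv ℝ (localRep (𝓡 2) X p) y (localRep (𝓡 2) Y p y)‖ ≤
      (D + (‖f p‖ + 1)) * ‖localRep (𝓡 2) X p y‖ := by
    filter_upwards [htgt, hD, hfb] with y hy hDy hfy
    have hb := lieBracket_localRep (hXat (φ.symm y)) (hY.contMDiffAt (hU.mem_nhds hy.2))
      (φ.map_target hy.1) (hbr _ hy.2)
    rw [φ.right_inv hy.1, VectorField.lieBracket_eq, sub_eq_iff_eq_add] at hb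
    rw [hb, add_mul, add_comm]
    refine (norm_add_le _ _).trans (add_le_add ?_ ?_)
    · exact (ContinuousLinearMap.le_opNorm _ _).trans (by gcongr)
    · rw [norm_smul]; gcongr
  have key := eventually_vanishesToOrder_of_zero (by simp) hn0 hXrep hYrep1 hYne hL hvan.1 hvan.2
  filter_upwards [(continuousAt_extChartAt (I := 𝓡 2) p).eventually key,
    (isOpen_extChartAt_source (I := 𝓡 2) p).mem_nhds hpφ] with q hq hqs hq0
  rw [← hn]
  exact (order_eq_coe_iff_vanishesToOrder hn0 (hXat q) hqs).2
    (hq ((localRep_eq_zero_iff hqs).2 hq0))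

end Order

end SurfaceVectorField

theorem theorem2 {M : Type*} [TopologicalSpace M] [T2Space M]
    [ChartedSpace (EuclideanSpace ℝ (Fin 2)) M] [IsManifold (𝓡 2) ∞ M]
    (X : ∀ x : M, TangentSpace (𝓡 2) x)
    (hX : SurfaceVectorField.SmoothOn X Set.univ)
    (hflat : SurfaceVectorField.zerosOfOrder X ⊤ = ∅)
    (hcomp : ∃ q ∈ SurfaceVectorField.zeros X, ∀ n : ℕ∞, 1 ≤ n →
      ¬ connectedComponentIn (SurfaceVectorField.zeros X) q ⊆
        SurfaceVectorField.zerosOfOrder X n) :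
    ∃ p : M, SurfaceVectorField.IsPrimarySingularity X p := by
  open SurfaceVectorField in
  by_contra! hno
  obtain ⟨q, hq, hcomp⟩ := hcomp
  have hfin : ∀ p ∈ zeros X, order X p ≠ ⊤ := fun p hp htop =>
    (hflat ▸ (show p ∈ zerosOfOrder X ⊤ from ⟨hp, htop⟩) : p ∈ (∅ : Set M))
  have hloc : ∀ p ∈ zeros X, ∀ᶠ x in 𝓝[zeros X] p, order X x = order X p := by
    intro p hp
    have := hno p
    simp only [IsPrimarySingularity, not_and, not_forall] at this
    obtain ⟨U, Y, hU, hpU, hY, htrack, hYp⟩ := this hp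
    exact eventually_nhdsWithin_iff.2
      (eventually_order_eq hX hU hpU hY htrack hYp hp (hfin p hp))
  set K := connectedComponentIn (zeros X) q
  have hKZ : K ⊆ zeros X := connectedComponentIn_subset _ _
  have hcont : ContinuousOn (fun x => (order X x).toNat) K := by
    intro p hp
    refine ContinuousWithinAt.mono ?_ hKZ
    exact tendsto_nhds_of_eventually_eq
      ((hloc p (hKZ hp)).mono fun x hx => congrArg ENat.toNat hx)
  refine hcomp (order X q) (Order.one_le_iff_ne_zero.2 (order_ne_zero hq)) fun x hx => ⟨hKZ hx, ?_⟩
  have := isPreconnected_connectedComponentIn.constant hcont hx (mem_connectedComponentIn hq)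
  rw [← ENat.natCast_toNat (hfin x (hKZ hx)), ← ENat.natCast_toNat (hfin q hq)]
  exact congrArg _ this
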